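/- Let $\Sigma$ be a finite alphabet and $L\subseteq\Sigma^*$ a regular language. Its syntactic monoid $\mathrm{Syn}(L)$ is the quotient of $\Sigma^*$ by the congruence $v\equiv_L w \iff \forall x,y\in\Sigma^*\,(xvy\in L\Leftrightarrow xwy\in L)$. A nondeterministic finite automaton (nfa) may have several initial states and has no $\varepsilon$-transitions. The nondeterministic state complexity $\mathrm{ns}(L)$ is the least number of states of an nfa accepting $L$. By a semilattice we mean a poset with all finite joins (in particular a bottom element), and morphisms of semilattices preserve all finite joins. A boolean representation of a monoid $M$ is a finite semilattice $S$ together with a monoid morphism $\rho$ from $M$ to the monoid of endomorphisms of $S$, whose multiplication is composition in diagrammatic order, i.e. $\rho(mn)=\rho(n)\circ\rho(m)$ and $\rho(1)=\mathrm{id}_S$. Its degree is the number of join-irreducible elements of $S$ (the bottom element is not join-irreducible). A boolean representation $\rho_2$ on $S_2$ extends a boolean representation $\rho_1$ on $S_1$ if there is an injective semilattice morphism $f\colon S_1\to S_2$ with $f(\rho_1(m)(s))=\rho_2(m)(f(s))$ for all $m\in M$, $s\in S_1$. Let $\mathrm{LQ}(L)$ be the finite semilattice, under union, of all finite unions of left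 derivatives $u^{-1}L=\{w : uw\in L\}$, $u\in\Sigma^*$. The canonical boolean representation $\kappa_L$ of $\mathrm{Syn}(L)$ on $\mathrm{LQ}(L)$ lets the class of $w$ act by $K\mapsto w^{-1}K$. The nondeterministic syntactic complexity $\mathrm{nsyn}(L)$ is the least degree of a boolean representation of $\mathrm{Syn}(L)$ extending $\kappa_L$. **Theorem.** If $\mathrm{Syn}(L)$ is a cyclic group, then $\mathrm{ns}(L)=\mathrm{nsyn}(L)$. -/

import Mathlib

universe u v

namespace SynComplexity

/-! ### The syntactic monoid -/

/-- The syntactic congruence of `L` on the free monoid of words: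
`v ≡ w` iff for all words `x, y`: `x v y ∈ L ↔ x w y ∈ L`. -/
def syntacticCon {α : Type u} (L : Language α) : Con (FreeMonoid α) where
  r v w := ∀ x y : FreeMonoid α, (x * v * y).toList ∈ L ↔ (x * w * y).toList ∈ L
  iseqv :=
    { refl := fun _ _ _ => Iff.rfl
      symm := fun h x y => (h x y).symm
      trans := fun h k x y => (h x y).trans (k x y) }
  mul' := by
    intro a b c d hab hcd x y
    have h1 := hab x (c * y)
    have h2 := hcd (x * b) y
    simp only [mul_assoc] at h1 h2 ⊢
    exact h1.trans h2

/-- The syntactic monoid of `L`. -/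
abbrev SynMonoid {α : Type u} (L : Language α) : Type u := (syntacticCon L).Quotient

/-! ### Boolean representations

A finite join-semilattice (with all finite joins) is a finite `SemilatticeSup` with `OrderBot`;
morphisms are `SupBotHom`s; join-irreducibles are `SupIrred` elements (which excludes `⊥`). -/

/-- A representation of the monoid `M` on the join-semilattice `S`: a monoid morphism from `M` to
the endomorphisms of `S`, where composition of endomorphisms is written in diagrammatic order
(first `m`, then `n`), the order for which a product of words acts by reading letters from left
to right. -/
structure Representation (M : Type u) [Monoid M] (S : Type v) [SemilatticeSup S] [OrderBot S] where
  act : M → SupBotHom S S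
  act_one : act 1 = SupBotHom.id S
  act_mul : ∀ m n : M, act (m * n) = (act n).comp (act m)

/-- The degree of a representation on `S`: the number of join-irreducibles of `S`. -/
noncomputable def Representation.degree {M : Type u} [Monoid M] {S : Type v} [SemilatticeSup S]
    [OrderBot S] (_ρ : Representation M S) : ℕ :=
  Nat.card {j : S // SupIrred j}

/-- `ρ₂` extends `ρ₁`: there is an injective equivariant semilattice morphism from `ρ₁` to
`ρ₂`. -/
def Representation.Extends {M : Type u} [Monoid M]
    {S₁ S₂ : Type v} [SemilatticeSup S₁] [OrderBot S₁] [SemilatticeSup S₂] [OrderBot S₂]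
    (ρ₂ : Representation M S₂) (ρ₁ : Representation M S₁) : Prop :=
  ∃ f : SupBotHom S₁ S₂, Function.Injective f ∧
    ∀ (m : M) (s : S₁), f (ρ₁.act m s) = ρ₂.act m (f s)

/-! ### The canonical representation -/

/-- The languages that are finite unions of left derivatives `u⁻¹L` of `L`. -/
def IsFinUnionLeftDeriv {α : Type u} (L K : Language α) : Prop :=
  ∃ F : Finset (List α), K = F.sup L.leftQuotient

/-- The join-semilattice, under union, of all finite unions of left derivatives of `L`. -/
abbrev LQ {α : Type u} (L : Language α) : Type u := {K : Language α // IsFinUnionLeftDeriv L K}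

theorem isFinUnionLeftDeriv_bot {α : Type u} (L : Language α) : IsFinUnionLeftDeriv L ⊥ :=
  ⟨∅, by simp⟩

theorem isFinUnionLeftDeriv_sup {α : Type u} (L : Language α) {K₁ K₂ : Language α}
    (h₁ : IsFinUnionLeftDeriv L K₁) (h₂ : IsFinUnionLeftDeriv L K₂) :
    IsFinUnionLeftDeriv L (K₁ ⊔ K₂) := by
  classical
  obtain ⟨F, rfl⟩ := h₁
  obtain ⟨G, rfl⟩ := h₂
  exact ⟨F ∪ G, by rw [Finset.sup_union]⟩

theorem isFinUnionLeftDeriv_leftQuotient {α : Type u} (L : Language α) {K : Language α}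
    (h : IsFinUnionLeftDeriv L K) (w : List α) : IsFinUnionLeftDeriv L (K.leftQuotient w) := by
  classical
  obtain ⟨F, rfl⟩ := h
  refine ⟨F.image (fun u => u ++ w), ?_⟩
  rw [Finset.sup_image,
    Finset.apply_sup_eq_sup_comp (fun K : Language α => K.leftQuotient w) (fun _ _ => rfl) rfl]
  congr 1
  funext u
  exact (L.leftQuotient_append u w).symm

instance {α : Type u} (L : Language α) : SemilatticeSup (LQ L) :=
  Subtype.semilatticeSup fun _ _ h₁ h₂ => isFinUnionLeftDeriv_sup L h₁ h₂

instance {α : Type u} (L : Language α) : OrderBot (LQ L) :=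
  Subtype.orderBot (isFinUnionLeftDeriv_bot L)

/-- The endomorphism `K ↦ w⁻¹K` of the semilattice of finite unions of left derivatives. -/
def derivHom {α : Type u} (L : Language α) (w : List α) : SupBotHom (LQ L) (LQ L) where
  toFun K := ⟨K.1.leftQuotient w, isFinUnionLeftDeriv_leftQuotient L K.2 w⟩
  map_sup' _ _ := rfl
  map_bot' := rfl

theorem derivHom_eq_of_con {α : Type u} (L : Language α) (v w : FreeMonoid α)
    (h : syntacticCon L v w) : derivHom L v.toList = derivHom L w.toList := by
  refine SupBotHom.ext fun K => Subtype.ext ?_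
  obtain ⟨K, F, rfl⟩ := K
  change (F.sup L.leftQuotient).leftQuotient v.toList
    = (F.sup L.leftQuotient).leftQuotient w.toList
  rw [Finset.apply_sup_eq_sup_comp (fun K : Language α => K.leftQuotient v.toList)
      (fun _ _ => rfl) rfl,
    Finset.apply_sup_eq_sup_comp (fun K : Language α => K.leftQuotient w.toList)
      (fun _ _ => rfl) rfl]
  congr 1
  funext u
  ext y
  have := h (FreeMonoid.ofList u) (FreeMonoid.ofList y)
  simpa [FreeMonoid.toList_mul] using this

/-- The canonical representation of the syntactic monoid of `L` on the semilattice of finite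
unions of left derivatives: the class of `w` acts by `K ↦ w⁻¹K`. -/
def canonicalRep {α : Type u} (L : Language α) : Representation (SynMonoid L) (LQ L) where
  act m := Con.liftOn m (fun w => derivHom L w.toList) (derivHom_eq_of_con L)
  act_one := rfl
  act_mul m n := by
    induction m using Con.induction_on with | H v => ?_
    induction n using Con.induction_on with | H w => ?_
    exact SupBotHom.ext fun K => Subtype.ext (K.1.leftQuotient_append v.toList w.toList)

/-! ### The two complexity measures -/

/-- The numbers of states of the nfas (several initial states allowed, no `ε`-moves)
accepting `L`. -/
def nfaSizes {α : Type u} (L : Language α) : Set ℕ :=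
  {n | ∃ (σ : Type) (_ : Fintype σ) (N : NFA α σ), N.accepts = L ∧ Fintype.card σ = n}

/-- The nondeterministic state complexity: the least number of states of an nfa accepting `L`. -/
noncomputable def ns {α : Type u} (L : Language α) : ℕ := sInf (nfaSizes L)

/-- The degrees of the boolean (that is, finite) representations of the syntactic monoid of `L`
that extend the canonical representation. -/
def extensionDegrees {α : Type u} (L : Language α) : Set ℕ :=
  {n | ∃ (S : Type u) (_ : SemilatticeSup S) (_ : OrderBot S) (_ : Finite S)
    (ρ : Representation (SynMonoid L) S), ρ.Extends (canonicalRep L) ∧ ρ.degree = n}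

/-- The nondeterministic syntactic complexity: the least degree of a boolean representation of the
syntactic monoid extending the canonical one. -/
noncomputable def nsyn {α : Type u} (L : Language α) : ℕ := sInf (extensionDegrees L)

/-! For a regular language both minima are attained, so the infima above are least elements. -/

theorem finite_LQ {α : Type u} {L : Language α} (hL : L.IsRegular) : Finite (LQ L) := by
  have hfin := hL.finite_range_leftQuotient
  refine Set.Finite.to_subtype (s := {K | IsFinUnionLeftDeriv L K})
    ((hfin.finite_subsets.image sSup).subset ?_)
  rintro K ⟨F, rfl⟩
  exact ⟨L.leftQuotient '' F, Set.image_subset_range _ _, (Finset.sup_eq_sSup_image F _).symm⟩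

theorem isLeast_ns {α : Type u} {L : Language α} (hL : L.IsRegular) :
    IsLeast (nfaSizes L) (ns L) := by
  refine ⟨Nat.sInf_mem ?_, fun _ h => Nat.sInf_le h⟩
  obtain ⟨σ, hσ, M, hM⟩ := hL
  exact ⟨_, σ, hσ, M.toNFA, by rw [DFA.toNFA_correct, hM], rfl⟩

theorem isLeast_nsyn {α : Type u} {L : Language α} (hL : L.IsRegular) :
    IsLeast (extensionDegrees L) (nsyn L) :=
  ⟨Nat.sInf_mem ⟨_, LQ L, inferInstance, inferInstance, finite_LQ hL, canonicalRep L,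
    ⟨SupBotHom.id _, Function.injective_id, fun _ _ => rfl⟩, rfl⟩, fun _ h => Nat.sInf_le h⟩

end SynComplexity

/-!
The inequality `ns L ≤ nsyn L` holds for every regular language. Given a finite extension `S` of
the canonical representation, the join-irreducibles of `S` are the states of an nfa: reading a
letter leads from `j` to the join-irreducibles below the image of `j`, and the initial states are
those below the image of `L`. The map `K ↦ (ε ∈ K)` on `LQ L` is `K ↦ (K ≰ K₀)` where `K₀` is the
largest element of `LQ L` not containing the empty word, and in this form it extends to `S`, which determines the final
states (`exists_nfa_of_extends`).

Conversely, let the syntactic monoid be a finite commutative group and let `N` be an nfa for `L`.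
Choose a base state `c` in each strongly connected component. The classes of the words labelling
loops at `c` form a subgroup `H`. The words `w` such that `H · [w]` is contained in the
image of `L` form a language `core c ≤ L`, a union of `H`-cosets, so its left quotients depend only
on the coset of the word. Call the component rich if the labels of chosen paths from `c` to the
states of the component already yield all left quotients of `core c`; this is the case if the labels
of the paths inside the component meet every coset of `H`. The left quotients of the cores of the
rich components are then indexed by states of `N`, and their joins form a representation whose
degree is at most the number of states of `N` (`exists_extensionDegree_le_of_family`).

It extends the canonical one because `L` is the union of the cores of the rich components
(`exists_rich_core`). Indeed, let `u` be a word of trivial class whose prefixes represent every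
class. For `w ∈ L` the word `uⁿw` belongs to `L`, and for `n` the number of states an accepting run
reads some factor `u` within a single component. This component is then rich, and as loops
may be inserted into the run, commutativity gives `w ∈ core c`.
-/

namespace SynComplexity

/-! ### From representations to automata -/

section ToNFA

variable {α : Type u}

/-- The nfa attached to an action of the letters on `S`, with states naming elements `j q` of `S`:
the letter `a` leads from `j q` to all named elements below the image of `j q`. -/
def nfaOfAction {S : Type v} [SemilatticeSup S] [OrderBot S] {σ : Type} (j : σ → S)
    (act : α → SupBotHom S S) (i k : S) : NFA α σ where
  step q a := {q' | j q' ≤ act a (j q)}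
  start := {q | j q ≤ i}
  accept := {q | ¬ j q ≤ k}

/-- If the named elements generate `S`, then the join of the states reached by a word is the image
of the join of the starting states. -/
theorem isLUB_evalFrom_nfaOfAction {M : Type u} [Monoid M] {S : Type v} [SemilatticeSup S]
    [OrderBot S] {σ : Type} [Finite σ] (j : σ → S) (hj : ∀ s, ∃ T : Finset σ, T.sup j = s)
    (ρ : Representation M S) (c : FreeMonoid α →* M) (i k : S) (w : List α) :
    ∀ (Q : Set σ) (s : S), IsLUB (j '' Q) s →
      IsLUB (j '' (nfaOfAction j (fun a => ρ.act (c (FreeMonoid.of a))) i k).evalFrom Q w)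
        (ρ.act (c (FreeMonoid.ofList w)) s) := by
  classical
  have := Fintype.ofFinite σ
  induction w with
  | nil =>
    intro Q s h
    simpa [ρ.act_one] using h
  | cons a w ih =>
    intro Q s h
    have hs : s = Q.toFinset.sup j := by
      refine h.unique ?_
      simpa using Finset.isLUB_sup (s := Q.toFinset) (f := j)
    rw [NFA.evalFrom_cons, FreeMonoid.ofList_cons, map_mul, ρ.act_mul, SupBotHom.comp_apply]
    refine ih _ _ ⟨?_, ?_⟩
    · rintro _ ⟨q, hq, rfl⟩
      obtain ⟨t, ht, hqt⟩ := NFA.mem_stepSet.1 hq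
      exact le_trans hqt (OrderHomClass.mono _ (h.1 ⟨t, ht, rfl⟩))
    · intro t ht
      rw [hs, map_finset_sup]
      refine Finset.sup_le fun q hq => ?_
      obtain ⟨T, hT⟩ := hj (ρ.act (c (FreeMonoid.of a)) (j q))
      rw [Function.comp_apply, ← hT]
      refine Finset.sup_le fun q' hq' => ht ⟨q', NFA.mem_stepSet.2 ⟨q, by simpa using hq, ?_⟩, rfl⟩
      change j q' ≤ _
      rw [← hT]
      exact Finset.le_sup hq'

/-- `L` as an element of its own semilattice of unions of left derivatives. -/
def LQ.self (L : Language α) : LQ L := ⟨L, {[]}, by simp⟩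

theorem exists_forall_nil_mem_iff {L : Language α} (hL : L.IsRegular) :
    ∃ K₀ : LQ L, ∀ K : LQ L, [] ∈ K.1 ↔ ¬ K ≤ K₀ := by
  classical
  have := finite_LQ hL
  have := Fintype.ofFinite (LQ L)
  refine ⟨(Finset.univ.filter fun K : LQ L => [] ∉ K.1).sup id, fun K => ?_⟩
  rw [iff_not_comm]
  constructor
  · intro h hK
    have h0 : [] ∉ ((Finset.univ.filter fun K : LQ L => [] ∉ K.1).sup id).1 := by
      refine Finset.sup_induction (p := fun K : LQ L => [] ∉ K.1) ?_ ?_ ?_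
      · exact fun h => h
      · rintro A hA B hB (h | h)
        · exact hA h
        · exact hB h
      · intro A hA
        exact (Finset.mem_filter.1 hA).2
    exact h0 (h hK)
  · intro h
    exact Finset.le_sup (f := id) (Finset.mem_filter.2 ⟨Finset.mem_univ _, h⟩)

theorem exists_nfa_of_extends {L : Language α} (hL : L.IsRegular) {S : Type u} [SemilatticeSup S]
    [OrderBot S] [Finite S] (ρ : Representation (SynMonoid L) S)
    (h : ρ.Extends (canonicalRep L)) : ρ.degree ∈ nfaSizes L := by
  classical
  obtain ⟨f, hf, hfe⟩ := h
  obtain ⟨K₀, hK₀⟩ := exists_forall_nil_mem_iff hL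
  let e : Fin ρ.degree ≃ {j : S // SupIrred j} := (Finite.equivFin _).symm
  let j : Fin ρ.degree → S := fun q => (e q).1
  have hj : ∀ s, ∃ T : Finset (Fin ρ.degree), T.sup j = s := by
    intro s
    obtain ⟨F, hF, hirr⟩ := exists_supIrred_decomposition s
    refine ⟨Finset.univ.filter fun q => j q ∈ F, le_antisymm ?_ ?_⟩
    · refine Finset.sup_le fun q hq => ?_
      rw [← hF]
      exact Finset.le_sup (f := id) (Finset.mem_filter.1 hq).2
    · rw [← hF]
      refine Finset.sup_le fun b hb => ?_
      have hb' : j (e.symm ⟨b, hirr hb⟩) = b := by simp [j]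
      have : j (e.symm ⟨b, hirr hb⟩) ≤ (Finset.univ.filter fun q => j q ∈ F).sup j :=
        Finset.le_sup (Finset.mem_filter.2 ⟨Finset.mem_univ _, by rwa [hb']⟩)
      rwa [hb'] at this
  refine ⟨Fin ρ.degree, inferInstance,
    nfaOfAction j (fun a => ρ.act ((syntacticCon L).mk' (FreeMonoid.of a))) (f (LQ.self L)) (f K₀),
    ?_, Fintype.card_fin _⟩
  have hstart : IsLUB (j '' {q | j q ≤ f (LQ.self L)}) (f (LQ.self L)) := by
    refine ⟨by rintro _ ⟨q, hq, rfl⟩; exact hq, fun t ht => ?_⟩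
    obtain ⟨T, hT⟩ := hj (f (LQ.self L))
    rw [← hT]
    refine Finset.sup_le fun q hq => ht ⟨q, ?_, rfl⟩
    change j q ≤ f (LQ.self L)
    rw [← hT]
    exact Finset.le_sup hq
  -- an injective join-preserving map reflects the order
  have hle : ∀ A B : LQ L, f A ≤ f B ↔ A ≤ B := by
    intro A B
    rw [← sup_eq_right, ← map_sup, hf.eq_iff, sup_eq_right]
  ext w
  have key := isLUB_evalFrom_nfaOfAction j hj ρ (syntacticCon L).mk' (f (LQ.self L)) (f K₀) w _ _
    hstart
  rw [← hfe] at key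
  have hw : w ∈ L ↔ ¬ (canonicalRep L).act ((syntacticCon L).mk' (FreeMonoid.ofList w))
      (LQ.self L) ≤ K₀ := by
    rw [← hK₀]
    change _ ↔ [] ∈ L.leftQuotient w
    simp
  rw [hw, ← hle, isLUB_le_iff key, NFA.mem_accepts]
  constructor
  · rintro ⟨q, hq, hqe⟩ hub
    exact hq (hub ⟨q, hqe, rfl⟩)
  · intro hub
    by_contra hno
    refine hub ?_
    rintro _ ⟨q, hq, rfl⟩
    by_contra hq'
    exact hno ⟨q, hq', hq⟩

theorem ns_le_nsyn {L : Language α} (hL : L.IsRegular) : ns L ≤ nsyn L := by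
  obtain ⟨S, _, _, _, ρ, hρ, hn⟩ := (isLeast_nsyn hL).1
  rw [← hn]
  exact (isLeast_ns hL).2 (exists_nfa_of_extends hL ρ hρ)

end ToNFA

/-! ### Representations on joins of a family of languages -/

section Family

variable {α : Type u} {ι : Type} (B : ι → Language α)

/-- The semilattice of finite joins of the languages `B i`. -/
abbrev JoinsOf : Type u := {K : Language α // ∃ T : Finset ι, K = T.sup B}

theorem exists_finset_sup_sup {K₁ K₂ : Language α} (h₁ : ∃ T : Finset ι, K₁ = T.sup B)
    (h₂ : ∃ T : Finset ι, K₂ = T.sup B) : ∃ T : Finset ι, K₁ ⊔ K₂ = T.sup B := by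
  classical
  obtain ⟨F, rfl⟩ := h₁
  obtain ⟨G, rfl⟩ := h₂
  exact ⟨F ∪ G, Finset.sup_union.symm⟩

instance : SemilatticeSup (JoinsOf B) :=
  Subtype.semilatticeSup fun _ _ h₁ h₂ => exists_finset_sup_sup B h₁ h₂

instance : OrderBot (JoinsOf B) := Subtype.orderBot ⟨∅, by simp⟩

theorem leftQuotient_finset_sup (T : Finset ι) (w : List α) :
    (T.sup B).leftQuotient w = T.sup fun i => (B i).leftQuotient w :=
  Finset.apply_sup_eq_sup_comp (fun K : Language α => K.leftQuotient w) (fun _ _ => rfl) rfl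

/-- The action of a word by left quotients on the joins of a family that is closed under them. -/
def joinsDerivHom (hB : ∀ i w, ∃ k, (B i).leftQuotient w = B k) (w : List α) :
    SupBotHom (JoinsOf B) (JoinsOf B) where
  toFun K := ⟨K.1.leftQuotient w, by
    classical
    obtain ⟨K, T, rfl⟩ := K
    choose k hk using fun i => hB i w
    refine ⟨T.image k, ?_⟩
    rw [leftQuotient_finset_sup, Finset.sup_image]
    exact Finset.sup_congr rfl fun i _ => hk i⟩
  map_sup' _ _ := rfl
  map_bot' := rfl

/-- The representation of the syntactic monoid of `L` on the joins of a family of languages that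
are closed under left quotients and on which syntactically congruent words act equally. -/
def joinsRep (L : Language α) (hB : ∀ i w, ∃ k, (B i).leftQuotient w = B k)
    (hcon : ∀ i v w, syntacticCon L (FreeMonoid.ofList v) (FreeMonoid.ofList w) →
      (B i).leftQuotient v = (B i).leftQuotient w) : Representation (SynMonoid L) (JoinsOf B) where
  act m := Con.liftOn m (fun w => joinsDerivHom B hB w.toList) fun v w h => by
    refine SupBotHom.ext fun K => Subtype.ext ?_
    obtain ⟨K, T, rfl⟩ := K
    change (T.sup B).leftQuotient v.toList = (T.sup B).leftQuotient w.toList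
    rw [leftQuotient_finset_sup, leftQuotient_finset_sup]
    exact Finset.sup_congr rfl fun i _ => hcon i _ _ h
  act_one := rfl
  act_mul m n := by
    induction m using Con.induction_on with | H v => ?_
    induction n using Con.induction_on with | H w => ?_
    exact SupBotHom.ext fun K => Subtype.ext (K.1.leftQuotient_append v.toList w.toList)

/-- A family generates a semilattice with at most as many join-irreducibles as it has members, as
each join-irreducible is a member. -/
theorem exists_extensionDegree_le_of_family [Finite ι] (L : Language α)
    (hB : ∀ i w, ∃ k, (B i).leftQuotient w = B k)
    (hcon : ∀ i v w, syntacticCon L (FreeMonoid.ofList v) (FreeMonoid.ofList w) →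
      (B i).leftQuotient v = (B i).leftQuotient w)
    (hL : ∃ T : Finset ι, L = T.sup B) : ∃ n ∈ extensionDegrees L, n ≤ Nat.card ι := by
  classical
  have hfin : Finite (JoinsOf B) := by
    refine Finite.of_surjective
      (fun T : Finset ι => (⟨T.sup B, T, rfl⟩ : JoinsOf B)) ?_
    rintro ⟨_, T, rfl⟩
    exact ⟨T, rfl⟩
  have hLQ : ∀ K : LQ L, ∃ T : Finset ι, K.1 = T.sup B := by
    rintro ⟨_, F, rfl⟩
    change ∃ T : Finset ι, F.sup L.leftQuotient = T.sup B
    refine Finset.sup_induction (p := fun K : Language α => ∃ T : Finset ι, K = T.sup B)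
      ⟨∅, by simp⟩ (fun _ h₁ _ h₂ => exists_finset_sup_sup B h₁ h₂) fun u _ => ?_
    exact (joinsDerivHom B hB u ⟨L, hL⟩).2
  refine ⟨_, ⟨JoinsOf B, inferInstance, inferInstance, hfin, joinsRep B L hB hcon, ?_, rfl⟩, ?_⟩
  · refine ⟨⟨⟨fun K => ⟨K.1, hLQ K⟩, fun _ _ => rfl⟩, rfl⟩, ?_, ?_⟩
    · intro A A' h
      exact Subtype.ext (congrArg (fun K : JoinsOf B => K.1) h)
    · intro m K
      induction m using Con.induction_on with | H v => ?_
      rfl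
  · let b : ι → JoinsOf B := fun i => ⟨B i, {i}, by simp⟩
    have hmem : ∀ s : {s : JoinsOf B // SupIrred s}, ∃ i, b i = s.1 := by
      rintro ⟨⟨_, T, rfl⟩, hs⟩
      have : T.sup b = ⟨T.sup B, T, rfl⟩ :=
        Subtype.ext (Finset.apply_sup_eq_sup_comp (fun K : JoinsOf B => K.1)
          (fun _ _ => rfl) rfl)
      obtain ⟨i, _, hi⟩ := hs.finset_sup_eq this
      exact ⟨i, hi⟩
    choose g hg using hmem
    refine Nat.card_le_card_of_injective g fun s t hst => Subtype.ext ?_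
    rw [← hg s, ← hg t, hst]

end Family

/-! ### Paths in an automaton -/

section Paths

variable {α : Type u} {σ : Type} {N : NFA α σ}

theorem mem_evalFrom_append {q r : σ} {Q : Set σ} {v w : List α} (h₁ : q ∈ N.evalFrom Q v)
    (h₂ : r ∈ N.evalFrom {q} w) : r ∈ N.evalFrom Q (v ++ w) := by
  rw [NFA.evalFrom_append]
  exact NFA.mem_evalFrom_iff_exists.2 ⟨q, h₁, h₂⟩

theorem exists_of_mem_evalFrom_append {r : σ} {Q : Set σ} {v w : List α}
    (h : r ∈ N.evalFrom Q (v ++ w)) : ∃ q ∈ N.evalFrom Q v, r ∈ N.evalFrom {q} w := by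
  rw [NFA.evalFrom_append] at h
  exact NFA.mem_evalFrom_iff_exists.1 h

/-- The `n`-fold repetition of the word `u`. -/
def wordPow (u : List α) (n : ℕ) : List α := (List.replicate n u).flatten

theorem wordPow_succ (u : List α) (n : ℕ) : wordPow u (n + 1) = u ++ wordPow u n := by
  simp [wordPow, List.replicate_succ]

theorem exists_run {u : List α} (n : ℕ) {Q : Set σ} {r : σ}
    (h : r ∈ N.evalFrom Q (wordPow u n)) :
    ∃ f : ℕ → σ, f 0 ∈ Q ∧ f n = r ∧ ∀ i < n, f (i + 1) ∈ N.evalFrom {f i} u := by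
  induction n generalizing Q with
  | zero => exact ⟨fun _ => r, h, rfl, by simp⟩
  | succ n ih =>
    rw [wordPow_succ] at h
    obtain ⟨q, hq, hr⟩ := exists_of_mem_evalFrom_append h
    obtain ⟨p, hp, hpq⟩ := NFA.mem_evalFrom_iff_exists.1 hq
    obtain ⟨f, hf0, hfn, hf⟩ := ih hr
    refine ⟨fun i => Nat.casesOn i p f, hp, hfn, ?_⟩
    intro i hi
    cases i with
    | zero =>
      have hf0' : f 0 = q := hf0
      change f 0 ∈ N.evalFrom {p} u
      rwa [hf0']
    | succ i => exact hf i (by omega)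

theorem mem_evalFrom_wordPow {u : List α} {n : ℕ} {f : ℕ → σ}
    (hf : ∀ i < n, f (i + 1) ∈ N.evalFrom {f i} u) (d a : ℕ) (h : a + d ≤ n) :
    f (a + d) ∈ N.evalFrom {f a} (wordPow u d) := by
  induction d generalizing a with
  | zero => simp [wordPow]
  | succ d ih =>
    rw [wordPow_succ]
    have := ih (a + 1) (by omega)
    rw [show a + 1 + d = a + (d + 1) by omega] at this
    exact mem_evalFrom_append (hf a (by omega)) this

/-- With as many repetitions of `u` as there are states, an accepting run is in the same state
at two of their boundaries, so one of the factors `u` is read along a part of a closed path. -/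
theorem exists_recurrent_of_mem_accepts [Finite σ] {u w : List α}
    (h : wordPow u (Nat.card σ) ++ w ∈ N.accepts) :
    ∃ q q' : σ, ∃ a b d : ℕ, q ∈ N.evalFrom N.start (wordPow u a) ∧ q' ∈ N.evalFrom {q} u ∧
      q ∈ N.evalFrom {q'} (wordPow u d) ∧
      ∃ r ∈ N.accept, r ∈ N.evalFrom {q} (wordPow u b ++ w) := by
  obtain ⟨r, hr, hrw⟩ := NFA.mem_accepts.1 h
  obtain ⟨p, hp, hpr⟩ := exists_of_mem_evalFrom_append hrw
  obtain ⟨f, hf0, hfn, hf⟩ := exists_run _ hp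
  have hrep : ∃ i j : ℕ, i < j ∧ j ≤ Nat.card σ ∧ f i = f j := by
    have := Fintype.ofFinite σ
    obtain ⟨i, j, hij, hfe⟩ := Fintype.exists_ne_map_eq_of_card_lt
      (fun i : Fin (Nat.card σ + 1) => f i) (by simp)
    have hne : (i : ℕ) ≠ j := fun h => hij (Fin.ext h)
    rcases lt_or_gt_of_ne hne with h | h
    · exact ⟨i, j, h, by omega, hfe⟩
    · exact ⟨j, i, h, by omega, hfe.symm⟩
  obtain ⟨i, j, hij, hj, hfe⟩ := hrep
  have hpath := fun d a => mem_evalFrom_wordPow hf d a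
  refine ⟨f i, f (i + 1), i, Nat.card σ - i, j - (i + 1), ?_, hf i (by omega), ?_, r, hr, ?_⟩
  · have := hpath i 0 (by omega)
    rw [zero_add] at this
    exact NFA.mem_evalFrom_iff_exists.2 ⟨_, hf0, this⟩
  · have := hpath (j - (i + 1)) (i + 1) (by omega)
    rwa [show i + 1 + (j - (i + 1)) = j by omega, ← hfe] at this
  · have := hpath (Nat.card σ - i) i (by omega)
    rw [show i + (Nat.card σ - i) = Nat.card σ by omega, hfn] at this
    exact mem_evalFrom_append this hpr

variable (N) in
/-- Mutual reachability of states; its classes are the strongly connected components. -/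
def componentSetoid : Setoid σ where
  r q q' := (∃ v, q' ∈ N.evalFrom {q} v) ∧ ∃ v, q ∈ N.evalFrom {q'} v
  iseqv :=
    { refl := fun q => ⟨⟨[], rfl⟩, [], rfl⟩
      symm := fun h => ⟨h.2, h.1⟩
      trans := by
        rintro q q' q'' ⟨⟨a, ha⟩, b, hb⟩ ⟨⟨c, hc⟩, d, hd⟩
        exact ⟨⟨_, mem_evalFrom_append ha hc⟩, _, mem_evalFrom_append hd hb⟩ }

variable (N) in
/-- The chosen base state of the strongly connected component of `q`. -/
noncomputable def base (q : σ) : σ := (Quotient.mk (componentSetoid N) q).out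

theorem base_rel (q : σ) : (componentSetoid N).r (base N q) q :=
  Quotient.exact (s := componentSetoid N) (Quotient.out_eq _)

variable (N) in
/-- The label of a chosen path from the base state to `q`. -/
noncomputable def pathLabel (q : σ) : List α := (base_rel (N := N) q).1.choose

theorem mem_evalFrom_pathLabel (q : σ) : q ∈ N.evalFrom {base N q} (pathLabel N q) :=
  (base_rel (N := N) q).1.choose_spec

theorem base_eq_of_paths {q q' : σ} {v w : List α} (h : q' ∈ N.evalFrom {q} v)
    (h' : q ∈ N.evalFrom {q'} w) : base N q' = base N q := by
  have : Quotient.mk (componentSetoid N) q' = Quotient.mk (componentSetoid N) q :=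
    Quotient.sound ⟨⟨w, h'⟩, v, h⟩
  rw [base, base, this]

end Paths

/-! ### Cores of strongly connected components -/

section Core

variable {α : Type u} {σ : Type}

/-- The words that belong to `L` after the label of any loop at `c`. -/
def core (N : NFA α σ) (L : Language α) (c : σ) : Language α :=
  {w | ∀ v, c ∈ N.evalFrom {c} v → v ++ w ∈ L}

/-- The component with base state `c` is rich if each left quotient of its core is the one by the
chosen path to some state of the component. -/
def IsRich (N : NFA α σ) (L : Language α) (c : σ) : Prop :=
  ∀ w, ∃ q, base N q = c ∧ (core N L c).leftQuotient w = (core N L c).leftQuotient (pathLabel N q)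

open Classical in
/-- The left quotient of the core of a rich component that belongs to its state `q`; the empty
language if the component of `q` is not rich. -/
noncomputable def stateQuotient (N : NFA α σ) (L : Language α) (q : σ) : Language α :=
  if IsRich N L (base N q) then (core N L (base N q)).leftQuotient (pathLabel N q) else ⊥

variable {N : NFA α σ} {L : Language α}

theorem core_le (c : σ) : core N L c ≤ L := fun _ hw => hw [] rfl

theorem stateQuotient_leftQuotient (q : σ) (w : List α) :
    ∃ q', (stateQuotient N L q).leftQuotient w = stateQuotient N L q' := by
  by_cases h : IsRich N L (base N q)
  · obtain ⟨q', hq', he⟩ := h (pathLabel N q ++ w)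
    refine ⟨q', ?_⟩
    rw [stateQuotient, stateQuotient, hq', if_pos h, if_pos h, ← Language.leftQuotient_append, he]
  · refine ⟨q, ?_⟩
    rw [stateQuotient, if_neg h]
    rfl

theorem core_leftQuotient_eq_of_con (c : σ) {v w : List α}
    (h : syntacticCon L (FreeMonoid.ofList v) (FreeMonoid.ofList w)) :
    (core N L c).leftQuotient v = (core N L c).leftQuotient w := by
  ext y
  refine forall_congr' fun l => imp_congr Iff.rfl ?_
  have := h (FreeMonoid.ofList l) (FreeMonoid.ofList y)
  simpa [FreeMonoid.toList_mul] using this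

theorem stateQuotient_leftQuotient_eq_of_con (q : σ) {v w : List α}
    (h : syntacticCon L (FreeMonoid.ofList v) (FreeMonoid.ofList w)) :
    (stateQuotient N L q).leftQuotient v = (stateQuotient N L q).leftQuotient w := by
  rw [stateQuotient]
  split_ifs
  · rw [← Language.leftQuotient_append, ← Language.leftQuotient_append]
    refine core_leftQuotient_eq_of_con _ ?_
    rw [FreeMonoid.ofList_append, FreeMonoid.ofList_append]
    exact (syntacticCon L).mul ((syntacticCon L).refl _) h
  · rfl

end Core

/-! ### Languages recognised by a finite commutative group -/

section Group

variable {α : Type u} {σ : Type} {N : NFA α σ} {L : Language α} {G : Type v} [Group G]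
  {φ : List α → G}

theorem map_wordPow (hφ : ∀ a b, φ (a ++ b) = φ a * φ b) (u : List α) (n : ℕ) :
    φ (wordPow u n) = φ u ^ n := by
  induction n with
  | zero => simpa [wordPow] using hφ [] []
  | succ n ih => rw [wordPow_succ, hφ, ih, pow_succ']

variable [Finite G]

/-- The values of loops at a state are closed under inversion, since the group is finite. -/
theorem exists_loop_inv (hφ : ∀ a b, φ (a ++ b) = φ a * φ b) {c : σ} {l : List α}
    (hl : c ∈ N.evalFrom {c} l) : ∃ l', c ∈ N.evalFrom {c} l' ∧ φ l' = (φ l)⁻¹ := by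
  refine ⟨wordPow l (orderOf (φ l) - 1), ?_, ?_⟩
  · exact mem_evalFrom_wordPow (f := fun _ => c) (fun _ _ => hl) _ 0 le_rfl
  · rw [map_wordPow hφ, eq_inv_iff_mul_eq_one, ← pow_succ,
      Nat.sub_add_cancel (orderOf_pos (φ l)), pow_orderOf_eq_one]

theorem exists_word_prefixes_surjective (hφ : ∀ a b, φ (a ++ b) = φ a * φ b)
    (hs : Function.Surjective φ) :
    ∃ u, φ u = 1 ∧ ∀ g, ∃ p s, u = p ++ s ∧ φ p = g := by
  classical
  have := Fintype.ofFinite G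
  have hT : ∀ T : Finset G, ∃ u, ∀ g ∈ T, ∃ p s, u = p ++ s ∧ φ p = g := by
    intro T
    induction T using Finset.induction_on with
    | empty => exact ⟨[], by simp⟩
    | insert g T _ ih =>
      obtain ⟨u, hu⟩ := ih
      obtain ⟨t, ht⟩ := hs ((φ u)⁻¹ * g)
      refine ⟨u ++ t, fun g' hg' => ?_⟩
      rcases Finset.mem_insert.1 hg' with rfl | hg'
      · exact ⟨u ++ t, [], by simp, by rw [hφ, ht, mul_inv_cancel_left]⟩
      · obtain ⟨p, s, rfl, hp⟩ := hu g' hg'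
        exact ⟨p, s ++ t, by simp, hp⟩
  obtain ⟨u, hu⟩ := hT Finset.univ
  obtain ⟨t, ht⟩ := hs (φ u)⁻¹
  refine ⟨u ++ t, by rw [hφ, ht, mul_inv_cancel], fun g => ?_⟩
  obtain ⟨p, s, rfl, hp⟩ := hu g (Finset.mem_univ _)
  exact ⟨p, s ++ t, by simp, hp⟩

/-- The core is invariant under the values of loops, so its left quotients depend only on the coset
of the word. -/
theorem core_leftQuotient_eq_of_loop (hφ : ∀ a b, φ (a ++ b) = φ a * φ b)
    (hL : ∀ v w, φ v = φ w → (v ∈ L ↔ w ∈ L)) {c : σ} {l w w' : List α}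
    (hl : c ∈ N.evalFrom {c} l) (h : φ w = φ l * φ w') :
    (core N L c).leftQuotient w = (core N L c).leftQuotient w' := by
  have aux : ∀ {l w w' : List α}, c ∈ N.evalFrom {c} l → φ w = φ l * φ w' →
      (core N L c).leftQuotient w' ≤ (core N L c).leftQuotient w := by
    intro l w w' hl h y hy v hv
    have h1 := hy (v ++ l) (mem_evalFrom_append hv hl)
    refine (hL _ _ ?_).1 h1
    simp only [hφ, h, mul_assoc]
  obtain ⟨l', hl', hinv⟩ := exists_loop_inv hφ hl
  exact le_antisymm (aux hl' (by rw [hinv, h, inv_mul_cancel_left])) (aux hl h)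

theorem exists_rich_core [Finite σ] (hN : N.accepts = L) (hφ : ∀ a b, φ (a ++ b) = φ a * φ b)
    (hs : Function.Surjective φ) (hcomm : ∀ a b : G, a * b = b * a)
    (hL : ∀ v w, φ v = φ w → (v ∈ L ↔ w ∈ L)) {w : List α} (hw : w ∈ L) :
    ∃ c, IsRich N L c ∧ w ∈ core N L c := by
  obtain ⟨u, hu, hpre⟩ := exists_word_prefixes_surjective hφ hs
  have hpow : ∀ n, φ (wordPow u n) = 1 := fun n => by rw [map_wordPow hφ, hu, one_pow]
  have hacc : wordPow u (Nat.card σ) ++ w ∈ N.accepts := by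
    rw [hN]
    exact (hL _ _ (by rw [hφ, hpow, one_mul])).2 hw
  obtain ⟨q, q', a, b, d, hstart, hq', hq, r, hr, hend⟩ := exists_recurrent_of_mem_accepts hacc
  obtain ⟨y, hy⟩ := (base_rel (N := N) q).2
  have hx := mem_evalFrom_pathLabel (N := N) q
  refine ⟨base N q, ?_, ?_⟩
  · intro z
    obtain ⟨p, s, rfl, hp⟩ := hpre ((φ (pathLabel N q))⁻¹ * φ z)
    -- the run passes through a state `t` of the component after reading the prefix `p`
    obtain ⟨t, ht, hts⟩ := exists_of_mem_evalFrom_append hq'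
    have htq := mem_evalFrom_append hts hq
    have hbase : base N t = base N q := base_eq_of_paths ht htq
    refine ⟨t, hbase, ?_⟩
    have htb := mem_evalFrom_append htq hy
    have hxt := mem_evalFrom_pathLabel (N := N) t
    rw [hbase] at hxt
    -- both words lead to `t` up to loops: complete them to loops by a common return path
    have hl₁ := mem_evalFrom_append (mem_evalFrom_append hx ht) htb
    have hl₂ := mem_evalFrom_append hxt htb
    obtain ⟨l', hl', hinv⟩ := exists_loop_inv hφ hl₂
    refine core_leftQuotient_eq_of_loop hφ hL (mem_evalFrom_append hl₁ hl') ?_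
    rw [hφ _ l', hinv, hφ (pathLabel N q ++ p), hφ (pathLabel N q) p, hp, hφ (pathLabel N t)]
    group
  · intro v hv
    -- insert `v` into the run, and compensate the detour from `q` to the base state and back
    obtain ⟨l', hl', hinv⟩ := exists_loop_inv hφ (mem_evalFrom_append hx hy)
    have hdetour := mem_evalFrom_append (mem_evalFrom_append (mem_evalFrom_append
      (mem_evalFrom_append (mem_evalFrom_append hstart hy) hv) hl') hx) hend
    have hmem : wordPow u a ++ y ++ v ++ l' ++ pathLabel N q ++ (wordPow u b ++ w) ∈ L := by
      rw [← hN]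
      exact NFA.mem_accepts.2 ⟨r, hr, hdetour⟩
    refine (hL _ _ ?_).1 hmem
    rw [hφ, hφ, hφ, hφ, hφ, hφ (wordPow u b), hφ v w, hinv, hpow, hpow, hφ]
    rw [one_mul, one_mul]
    congr 1
    rw [mul_inv_rev, ← mul_assoc (φ y * φ v), inv_mul_cancel_right, hcomm (φ y),
      mul_inv_cancel_right]

theorem exists_extensionDegree_le_card [Finite σ] (hN : N.accepts = L)
    (hφ : ∀ a b, φ (a ++ b) = φ a * φ b) (hs : Function.Surjective φ)
    (hcomm : ∀ a b : G, a * b = b * a) (hL : ∀ v w, φ v = φ w → (v ∈ L ↔ w ∈ L)) :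
    ∃ n ∈ extensionDegrees L, n ≤ Nat.card σ := by
  classical
  have := Fintype.ofFinite σ
  refine exists_extensionDegree_le_of_family (stateQuotient N L) L stateQuotient_leftQuotient
    (fun q v w h => stateQuotient_leftQuotient_eq_of_con q h)
    ⟨Finset.univ.filter fun q => stateQuotient N L q ≤ L, le_antisymm ?_ ?_⟩
  · intro w hw
    obtain ⟨c, hc, hwc⟩ := exists_rich_core hN hφ hs hcomm hL hw
    -- the core itself is its left quotient by the empty word
    obtain ⟨q, rfl, he⟩ := hc []
    have hq : stateQuotient N L q = core N L (base N q) := by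
      rw [stateQuotient, if_pos hc, ← he, Language.leftQuotient_nil]
    have hle : stateQuotient N L q ≤ (Finset.univ.filter fun q => stateQuotient N L q ≤ L).sup
        (stateQuotient N L) :=
      Finset.le_sup (Finset.mem_filter.2 ⟨Finset.mem_univ _, hq ▸ core_le _⟩)
    exact hle (hq ▸ hwc)
  · exact Finset.sup_le fun q hq => (Finset.mem_filter.1 hq).2

end Group

/-! ### The syntactic monoid of a regular language -/

/-- The syntactic monoid acts faithfully on the finite semilattice `LQ L`. -/
theorem finite_synMonoid {α : Type u} {L : Language α} (hL : L.IsRegular) :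
    Finite (SynMonoid L) := by
  have := finite_LQ hL
  have : Finite (SupBotHom (LQ L) (LQ L)) := DFunLike.finite _
  refine Finite.of_injective (canonicalRep L).act fun m n h => ?_
  induction m using Con.induction_on with | H v => ?_
  induction n using Con.induction_on with | H w => ?_
  refine (Con.eq _).2 fun x y => ?_
  have hx := DFunLike.congr_fun h ⟨L.leftQuotient x.toList, {x.toList}, by simp⟩
  have hx' : (L.leftQuotient x.toList).leftQuotient v.toList
      = (L.leftQuotient x.toList).leftQuotient w.toList := congrArg (fun K : LQ L => K.1) hx
  have hy : y.toList ∈ (L.leftQuotient x.toList).leftQuotient v.toList ↔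
      y.toList ∈ (L.leftQuotient x.toList).leftQuotient w.toList := by rw [hx']
  simpa [FreeMonoid.toList_mul] using hy

theorem mem_iff_of_con {α : Type u} {L : Language α} {v w : List α}
    (h : syntacticCon L (FreeMonoid.ofList v) (FreeMonoid.ofList w)) : v ∈ L ↔ w ∈ L := by
  simpa using h 1 1

theorem nsyn_le_ns {α : Type u} {L : Language α} (hL : L.IsRegular) {G : Type v} [Group G]
    (hcomm : ∀ a b : G, a * b = b * a) (e : SynMonoid L ≃* G) : nsyn L ≤ ns L := by
  have := finite_synMonoid hL
  have : Finite G := Finite.of_equiv _ e.toEquiv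
  obtain ⟨σ, _, N, hN, hcard⟩ := (isLeast_ns hL).1
  obtain ⟨n, hn, hle⟩ := exists_extensionDegree_le_card
    (φ := fun w => e ((syntacticCon L).mk' (FreeMonoid.ofList w))) hN
    (fun a b => by rw [FreeMonoid.ofList_append, map_mul, map_mul])
    (fun g => by
      obtain ⟨w, hw⟩ := Con.mk'_surjective (c := syntacticCon L) (e.symm g)
      exact ⟨w.toList, by simp [hw]⟩)
    hcomm (fun v w h => mem_iff_of_con ((Con.eq _).1 (e.injective h)))
  rw [Nat.card_eq_fintype_card, hcard] at hle
  exact ((isLeast_nsyn hL).2 hn).trans hle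

end SynComplexity

theorem mainTheorem4 {α : Type u} [Finite α] (L : Language α) (hL : L.IsRegular)
    {G : Type v} [Group G] [IsCyclic G] (e : SynComplexity.SynMonoid L ≃* G) :
    SynComplexity.ns L = SynComplexity.nsyn L :=
  le_antisymm (SynComplexity.ns_le_nsyn hL)
    (SynComplexity.nsyn_le_ns hL (fun a b => (IsCyclic.commGroup (α := G)).mul_comm a b) e)
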